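/- Let $n \ge 0$ be an integer and let $\Gamma_1,\dots,\Gamma_n$ be groups of type $\mathrm{FP}_n(\mathbb{Z})$, i.e. for each $i$ the trivial $\mathbb{Z}\Gamma_i$-module $\mathbb{Z}$ has a resolution by projective $\mathbb{Z}\Gamma_i$-modules whose terms in degrees $0,\dots,n$ are finitely generated. Let $\phi:\Gamma_1\times\cdots\times\Gamma_n\to\mathbb{Z}$ be a group homomorphism whose restriction to each factor $\Gamma_i$ is non-trivial. Then, for every integer $j$ with $0\le j\le n-1$, the homology group $H_j(\ker\phi;\mathbb{Z})$ (with trivial coefficients $\mathbb{Z}$) is a finitely generated abelian group. -/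

import Mathlib

open CategoryTheory
open scoped MonoidAlgebra

universe u

/-- The group `G` is of type `FP_n(k)`: the trivial `k[G]`-module `k` has a projective resolution
whose terms in degrees `0, …, n` are finitely generated as `k[G]`-modules. (`Rep k G` is the
category of `k[G]`-modules.) -/
def IsFP (k : Type u) [CommRing k] (G : Type u) [Group G] (n : ℕ) : Prop :=
  ∃ P : ProjectiveResolution (Rep.trivial k G k),
    ∀ i ≤ n, Module.Finite k[G] (P.complex.X i).ρ.asModule

/-- The ring of integers, placed in the universe of the groups under consideration
(Mathlib's `groupHomology` takes the ring and the group in the same universe). -/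
def UInteger : Type u := ULift.{u} ℤ

noncomputable instance : CommRing UInteger.{u} := inferInstanceAs (CommRing (ULift.{u} ℤ))

/-- `UInteger` is the ring of integers. -/
noncomputable def UInteger.ringEquivInt : UInteger.{u} ≃+* ℤ :=
  (ULift.ringEquiv : ULift.{u} ℤ ≃+* ℤ)

/-- The integral homology `H_j(G; ℤ)`, with coefficients in the trivial module `ℤ`. -/
noncomputable abbrev integralHomology (G : Type u) [Group G] (j : ℕ) : ModuleCat.{u} UInteger.{u} :=
  groupHomology (Rep.trivial UInteger.{u} G UInteger.{u}) j

/-!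
The kernel of `φ` has infinite index, so finiteness does not simply pass to it from the product;
it is recovered, one degree for each factor, from the action of the infinite cyclic quotient.

Let `k` be the integers, `G` the product of the `Γ i`, `Q` the image of `φ`, `R = k[Q]`, and let
`χ : G → R` send `g` to the group ring element of its image in `Q`. By Shapiro's lemma
(`nonempty_groupHomology_ker_addEquiv`), `H_j(ker φ; k)` is, as an abelian group, the homology
`H_j(G; R_χ)` of the rank one `R`-representation `charRep χ`. Here `R` is noetherian, and an
`R`-module that is finitely generated and killed by `x - 1` for some `x ≠ 1` in `Q` is finitely
generated over `ℤ`, because `R / (x - 1) = k[Q / ⟨x⟩]` with `Q / ⟨x⟩` finite.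

One now adds the factors one at a time, for an arbitrary character `χ` with values in a noetherian
flat `k`-algebra. For `E = Γ × G'`, the functors `B ↦ H_j(E; R ⊗ B)` on representations of `Γ`
(`twistedHomology`) form a homological functor, because `R` is flat; it takes the trivial
representation to `H_j(E; R_χ)` and, by Shapiro's lemma, `k[Γ]` to `H_j(G'; R_χ)`. Dimension
shifting along a partial resolution of the trivial representation by finitely generated projectives
then gives two statements.

* If `H_i(G'; R_χ)` is finitely generated over `R` for all `i ≤ j`, then so is `H_j(E; R_χ)`
  (`isNoetherian_groupHomology_prod`).
* If moreover `H_i(G'; R_χ)` is finitely generated over `ℤ` for all `i < j`, and `R / (χ γ - 1)` is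
  finitely generated over `ℤ` for some `γ` in `Γ`, then `H_j(E; R_χ)` is finitely generated over `ℤ`
  (`isNoetherian_int_groupHomology_prod`).

The gain of one degree in the second statement comes from the top step of the dimension shift, where
only the image of `H_j(E; R ⊗ k[Γ])` in `H_j(E; R_χ)` matters. This image is finitely generated over
`R`, and it is killed by `χ z - 1` for every `z` in `Γ` (`smul_twistedHomology_map_eq`): such a `z`
centralises `G'`, hence translation by `z` acts trivially on the homology of a representation
induced from `G'` (`groupHomology.map_indTranslate`), since on the restriction to `G'` of a projective
resolution over `E` the action of `z` lifts the identity and so is homotopic to it. Under Shapiro's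
lemma that translation is `χ z` times right multiplication by `z` on `k[Γ]`, and the latter
disappears after mapping `k[Γ]` to the trivial representation.
-/

/-! ### Partial resolutions by finitely generated projective representations -/

section FinitenessProperties

open Limits

variable {k Γ : Type u} [CommRing k] [Group Γ]

/-- The representation `F` is a direct summand of a free `k[Γ]`-module of finite rank. -/
def IsFGProjective (F : Rep.{u} k Γ) : Prop :=
  ∃ a : ℕ, Nonempty (Retract F (Rep.free k Γ (Fin a)))

/-- The representation `B` has a partial resolution `F_m ⟶ ⋯ ⟶ F₀ ⟶ B ⟶ 0` by finitely generated
projective `k[Γ]`-modules, encoded recursively by its syzygies. -/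
def HasFGPartialResolution : ℕ → Rep.{u} k Γ → Prop
  | 0, B => ∃ (F : Rep.{u} k Γ) (π : F ⟶ B), IsFGProjective F ∧ Epi π
  | m + 1, B => ∃ (K F : Rep.{u} k Γ) (ι : K ⟶ F) (π : F ⟶ B) (w : ι ≫ π = 0),
      (ShortComplex.mk ι π w).ShortExact ∧ IsFGProjective F ∧ HasFGPartialResolution m K

lemma HasFGPartialResolution.of_iso {m : ℕ} {B C : Rep.{u} k Γ} (e : B ≅ C)
    (h : HasFGPartialResolution m B) : HasFGPartialResolution m C := by
  cases m with
  | zero =>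
    obtain ⟨F, π, hF, hπ⟩ := h
    exact ⟨F, π ≫ e.hom, hF, epi_comp _ _⟩
  | succ m =>
    obtain ⟨K, F, ι, π, w, hX, hF, hK⟩ := h
    refine ⟨K, F, ι, π ≫ e.hom, by rw [← Category.assoc, w, zero_comp], ?_, hF, hK⟩
    exact ShortComplex.shortExact_of_iso (S₁ := ShortComplex.mk ι π w)
      (ShortComplex.isoMk (Iso.refl _) (Iso.refl _) e (by simp) (by simp)) hX

/-- A projective representation that is finitely generated as a `k[Γ]`-module is a retract of the
free representation on its generators. -/
lemma isFGProjective_of_projective_of_finite (F : Rep.{u} k Γ) [Projective F]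
    [Module.Finite k[Γ] F.ρ.asModule] : IsFGProjective F := by
  obtain ⟨a, s, hs⟩ := Module.Finite.exists_fin (R := k[Γ]) (M := F.ρ.asModule)
  let p : Rep.free k Γ (Fin a) ⟶ F := Rep.freeLift k Γ F fun i => F.ρ.asModuleEquiv (s i)
  have hp : Epi p := by
    rw [Rep.epi_iff_surjective]
    suffices H : ∀ y : F.ρ.asModule, ∃ z, p.hom z = F.ρ.asModuleEquiv y from
      fun x => H (F.ρ.asModuleEquiv.symm x)
    intro y
    have hy : y ∈ Submodule.span k[Γ] (Set.range s) := hs ▸ Submodule.mem_top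
    induction hy using Submodule.span_induction with
    | mem y hy =>
      obtain ⟨i, rfl⟩ := hy
      exact ⟨Finsupp.single i (.single 1 1), by simp [p]⟩
    | zero => exact ⟨0, by simp⟩
    | add y z _ _ hy hz =>
      obtain ⟨y', hy⟩ := hy
      obtain ⟨z', hz⟩ := hz
      exact ⟨y' + z', by rw [map_add, map_add, hy, hz]⟩
    | smul r y _ hy =>
      obtain ⟨y', hy⟩ := hy
      induction r using MonoidAlgebra.induction_on with
      | of g =>
        refine ⟨(Rep.free k Γ (Fin a)).ρ g y', ?_⟩
        rw [Rep.hom_comm_apply, hy, Representation.asModuleEquiv_map_smul,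
          Representation.asAlgebraHom_of]
      | add r r' h h' =>
        obtain ⟨z, hz⟩ := h
        obtain ⟨z', hz'⟩ := h'
        exact ⟨z + z', by rw [map_add, add_smul, map_add, hz, hz']⟩
      | smul c r h =>
        obtain ⟨z, hz⟩ := h
        refine ⟨c • z, ?_⟩
        rw [map_smul, hz, Representation.asModuleEquiv_map_smul,
          Representation.asModuleEquiv_map_smul, map_smul]
        rfl
  exact ⟨a, ⟨⟨Projective.factorThru (𝟙 F) p, p, Projective.factorThru_comp _ _⟩⟩⟩

/-- The syzygies of a projective resolution, written as cokernels of its differentials, inherit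
partial resolutions of shorter length. -/
lemma hasFGPartialResolution_of_isFP {n : ℕ} (h : IsFP k Γ n) :
    HasFGPartialResolution n (Rep.trivial k Γ k) := by
  obtain ⟨P, hP⟩ := h
  have key : ∀ m i, i + m ≤ n →
      HasFGPartialResolution m (cokernel (P.complex.d (i + 1) i)) := by
    intro m
    induction m with
    | zero =>
      intro i hi
      have := hP i (by omega)
      exact ⟨_, cokernel.π _, isFGProjective_of_projective_of_finite _, inferInstance⟩
    | succ m ih =>
      intro i hi
      have := hP i (by omega)
      have hd : P.complex.d (i + 2) (i + 1) ≫ P.complex.d (i + 1) i = 0 := P.complex.d_comp_d _ _ _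
      let ι : cokernel (P.complex.d (i + 2) (i + 1)) ⟶ P.complex.X i := cokernel.desc _ _ hd
      have hι : Mono ι := (ShortComplex.exact_iff_mono_cokernel_desc _).1 (P.exact_succ i)
      have w : ι ≫ cokernel.π (P.complex.d (i + 1) i) = 0 := by
        rw [← cancel_epi (cokernel.π _)]
        simp [ι]
      refine ⟨_, _, ι, cokernel.π _, w, ?_, isFGProjective_of_projective_of_finite _,
        ih (i + 1) (by omega)⟩
      refine ShortComplex.ShortExact.mk' ?_ hι inferInstance
      have h1 := ShortComplex.exact_cokernel (P.complex.d (i + 1) i)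
      let φ : ShortComplex.mk _ _ (cokernel.condition (P.complex.d (i + 1) i)) ⟶
          ShortComplex.mk _ _ w :=
        { τ₁ := cokernel.π _, τ₂ := 𝟙 _, τ₃ := 𝟙 _, comm₁₂ := by simp [ι], comm₂₃ := by simp }
      have : Epi φ.τ₁ := inferInstanceAs (Epi (cokernel.π _))
      have : IsIso φ.τ₂ := inferInstanceAs (IsIso (𝟙 _))
      have : Mono φ.τ₃ := inferInstanceAs (Mono (𝟙 _))
      exact (ShortComplex.exact_iff_of_epi_of_isIso_of_mono φ).1 h1
  refine (key n 0 (by omega)).of_iso ?_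
  exact (cokernelIsCokernel _).coconePointUniqueUpToIso P.isColimitCokernelCofork

end FinitenessProperties

/-! ### Base change twisted by a character -/

section TwistedBaseChange

open TensorProduct

variable {k R Γ E : Type u} [CommRing k] [CommRing R] [Algebra k R] [Group Γ] [Group E]

/-- The rank one representation of `E` over `R` in which `e` acts as multiplication by `χ e`. -/
noncomputable abbrev charRep (χ : E →* R) : Rep.{u} R E :=
  Rep.of (X := R) ((Algebra.lsmul R R R).toMonoidHom.comp χ)

/-- The representation `R ⊗[k] B` of `E` over `R`, where `e` acts as `χ e` on `R` and as `q e`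
on the representation `B` of `Γ`. -/
noncomputable abbrev twistedRep (χ : E →* R) (q : E →* Γ) (B : Rep.{u} k Γ) : Rep.{u} R E :=
  Rep.of (X := R ⊗[k] B)
    { toFun := fun e => χ e • (B.ρ (q e)).baseChange R
      map_one' := by ext; simp
      map_mul' := fun a b => by
        ext x
        simp [TensorProduct.smul_tmul', mul_comm] }

lemma twistedRep_ρ_tmul (χ : E →* R) (q : E →* Γ) (B : Rep.{u} k Γ) (e : E) (r : R) (b : B) :
    (twistedRep χ q B).ρ e (r ⊗ₜ[k] b) = (χ e * r) ⊗ₜ[k] B.ρ (q e) b := by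
  simp [TensorProduct.smul_tmul']

/-- The functor `B ↦ R ⊗[k] B` from representations of `Γ` over `k` to representations of `E`
over `R`, with the action of `twistedRep`. -/
noncomputable def twistedFunctor (χ : E →* R) (q : E →* Γ) : Rep.{u} k Γ ⥤ Rep.{u} R E where
  obj B := twistedRep χ q B
  map {B C} f := Rep.ofHom ⟨f.hom.toLinearMap.baseChange R, fun e => by
    ext x
    simp [Rep.hom_comm_apply]⟩
  map_id B := by ext; simp
  map_comp f g := by ext; simp

instance twistedFunctor_additive (χ : E →* R) (q : E →* Γ) :
    (twistedFunctor (k := k) χ q).Additive where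
  map_add {B C f g} := by
    exact Rep.hom_ext (Representation.IntertwiningMap.ext
      (LinearMap.baseChange_add (A := R) f.hom.toLinearMap g.hom.toLinearMap))

lemma twistedFunctor_shortExact [Module.Flat k R] (χ : E →* R) (q : E →* Γ)
    {X : ShortComplex (Rep.{u} k Γ)} (hX : X.ShortExact) :
    (X.map (twistedFunctor χ q)).ShortExact := by
  have hf := (Rep.mono_iff_injective X.f).1 hX.mono_f
  have hg := (Rep.epi_iff_surjective X.g).1 hX.epi_g
  have hfg : Function.Exact X.f.hom.toLinearMap X.g.hom.toLinearMap :=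
    (ShortComplex.ShortExact.moduleCat_exact_iff_function_exact _).1
      (hX.exact.map (forget₂ (Rep k Γ) (ModuleCat k)))
  refine ShortComplex.ShortExact.mk' ?_ ?_ ?_
  · rw [← ShortComplex.exact_map_iff_of_faithful _ (forget₂ (Rep R E) (ModuleCat R)),
      ShortComplex.ShortExact.moduleCat_exact_iff_function_exact]
    exact lTensor_exact R hfg hg
  · exact (Rep.mono_iff_injective _).2 (Module.Flat.lTensor_preserves_injective_linearMap _ hf)
  · exact (Rep.epi_iff_surjective _).2 (LinearMap.lTensor_surjective R hg)

/-- `R ⊗[k] k` with the twisted action is the rank one representation `charRep χ`. -/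
noncomputable def twistedTrivialIso (χ : E →* R) (q : E →* Γ) :
    (twistedFunctor χ q).obj (Rep.trivial k Γ k) ≅ charRep χ :=
  Rep.mkIso (.mk (TensorProduct.AlgebraTensorModule.rid k R R) fun e => by
    ext
    simp)

end TwistedBaseChange

section Additivity

open TensorProduct

variable {k G : Type u} [CommRing k] [Group G]

instance groupHomology.chainsFunctor_additive : (groupHomology.chainsFunctor k G).Additive where
  map_add {A B f g} := by
    refine HomologicalComplex.hom_ext _ _ fun i => ModuleCat.hom_ext ?_
    refine Finsupp.lhom_ext fun x a => ?_
    change ((groupHomology.chainsMap (MonoidHom.id G) (f + g)).f i).hom _ =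
      ((groupHomology.chainsMap (MonoidHom.id G) f).f i).hom _ +
      ((groupHomology.chainsMap (MonoidHom.id G) g).f i).hom _
    simp only [groupHomology.chainsMap_id_f_hom_eq_mapRange]
    simp [Rep.add_hom]

instance groupHomology.functor_additive (n : ℕ) : (groupHomology.functor k G n).Additive :=
  inferInstanceAs (groupHomology.chainsFunctor k G ⋙
    HomologicalComplex.homologyFunctor (ModuleCat k) (ComplexShape.down ℕ) n).Additive
end Additivity

/-! ### Dimension shifting in a Serre class -/

section FactorsThroughProperty

open Limits

variable {𝒜 : Type*} [Category 𝒜]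

/-- The morphism `f` factors through an object satisfying `P`. If `P` is a Serre class this says
that the image of `f` satisfies `P`. -/
def FactorsThroughProp (P : ObjectProperty 𝒜) {X Y : 𝒜} (f : X ⟶ Y) : Prop :=
  ∃ (Z : 𝒜) (a : X ⟶ Z) (b : Z ⟶ Y), P Z ∧ a ≫ b = f

namespace FactorsThroughProp

variable {P : ObjectProperty 𝒜} {X Y Z : 𝒜}

lemma of_prop_left (f : X ⟶ Y) (h : P X) : FactorsThroughProp P f :=
  ⟨X, 𝟙 X, f, h, Category.id_comp f⟩

lemma precomp {f : X ⟶ Y} (h : FactorsThroughProp P f) (g : Z ⟶ X) :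
    FactorsThroughProp P (g ≫ f) := by
  obtain ⟨W, a, b, hW, rfl⟩ := h
  exact ⟨W, g ≫ a, b, hW, Category.assoc _ _ _⟩

variable [Abelian 𝒜] [P.IsSerreClass]

lemma zero : FactorsThroughProp P (0 : X ⟶ Y) :=
  ⟨_, 0, 0, P.prop_zero, comp_zero⟩

lemma add {f g : X ⟶ Y} (hf : FactorsThroughProp P f) (hg : FactorsThroughProp P g) :
    FactorsThroughProp P (f + g) := by
  obtain ⟨V, a, b, hV, rfl⟩ := hf
  obtain ⟨W, c, d, hW, rfl⟩ := hg
  exact ⟨V ⊞ W, biprod.lift a c, biprod.desc b d, P.prop_biprod hV hW, by simp⟩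

lemma sum {ι : Type*} (s : Finset ι) {f : ι → (X ⟶ Y)}
    (hf : ∀ i ∈ s, FactorsThroughProp P (f i)) :
    FactorsThroughProp P (∑ i ∈ s, f i) :=
  Finset.sum_induction f (FactorsThroughProp P) (fun _ _ => add) zero hf

/-- If `X ⟶ Y ⟶ Z` is exact, `X ⟶ Y` factors through an object of the Serre class `P`, and `Z`
belongs to `P`, then so does `Y`. -/
lemma prop_of_exact {S : ShortComplex 𝒜} (hS : S.Exact) (hf : FactorsThroughProp P S.f)
    (h₃ : P S.X₃) : P S.X₂ := by
  obtain ⟨W, a, b, hW, hab⟩ := hf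
  have hbar : P (image S.f) := by
    refine P.prop_of_mono (image.eqToHom hab.symm ≫ image.preComp a b) ?_
    exact P.prop_of_epi (factorThruImage b) hW
  let φ : S ⟶ ShortComplex.mk (image.ι S.f) S.g (by
      rw [← cancel_epi (factorThruImage S.f)]; simp) :=
    { τ₁ := factorThruImage S.f, τ₂ := 𝟙 _, τ₃ := 𝟙 _ }
  have : Epi φ.τ₁ := inferInstanceAs (Epi (factorThruImage S.f))
  have : IsIso φ.τ₂ := inferInstanceAs (IsIso (𝟙 _))
  have : Mono φ.τ₃ := inferInstanceAs (Mono (𝟙 _))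
  exact P.prop_X₂_of_exact (S := ShortComplex.mk (image.ι S.f) S.g _)
    ((ShortComplex.exact_iff_of_epi_of_isIso_of_mono φ).1 hS) hbar h₃

lemma prop_of_epi (f : X ⟶ Y) [Epi f] (hf : FactorsThroughProp P f) : P Y := by
  obtain ⟨W, a, b, hW, rfl⟩ := hf
  have : Epi b := epi_of_epi a b
  exact P.prop_of_epi b hW

end FactorsThroughProp

end FactorsThroughProperty

section DimensionShifting

open Limits

variable {k R Γ E : Type u} [CommRing k] [CommRing R] [Algebra k R] [Group Γ] [Group E]

/-- In an additive functor, the image of a map out of a finitely generated projective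
representation is controlled by the images of the maps out of `k[Γ]`. -/
lemma IsFGProjective.factorsThroughProp_map {𝒜 : Type*} [Category 𝒜] [Abelian 𝒜]
    (P : ObjectProperty 𝒜) [P.IsSerreClass] (T : Rep.{u} k Γ ⥤ 𝒜) [T.Additive]
    {F B : Rep.{u} k Γ} (hF : IsFGProjective F) (f : F ⟶ B)
    (h : ∀ g : Rep.leftRegular k Γ ⟶ B, FactorsThroughProp P (T.map g)) :
    FactorsThroughProp P (T.map f) := by
  obtain ⟨a, ⟨r⟩⟩ := hF
  let p (i : Fin a) : Rep.free k Γ (Fin a) ⟶ Rep.leftRegular k Γ :=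
    Rep.freeLift k Γ _ fun j => if i = j then .single 1 1 else 0
  let s (i : Fin a) : Rep.leftRegular k Γ ⟶ Rep.free k Γ (Fin a) :=
    Rep.leftRegularHom _ (Finsupp.single i (.single 1 1))
  have hps : ∑ i, p i ≫ s i = 𝟙 _ := by
    refine Rep.free_ext k Γ _ _ _ fun j => ?_
    rw [Rep.sum_hom, Representation.IntertwiningMap.sum_apply, Finset.sum_eq_single j]
    · simp [p, s]
    · intro i _ hij
      simp [p, hij]
    · simp
  have hf : T.map f = ∑ i, T.map (r.i ≫ p i) ≫ T.map (s i ≫ r.r ≫ f) := by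
    simp only [← T.map_comp, ← T.map_sum]
    congr 1
    calc f = r.i ≫ (∑ i, p i ≫ s i) ≫ r.r ≫ f := by simp [hps]
      _ = _ := by simp [Preadditive.sum_comp, Preadditive.comp_sum]
  rw [hf]
  exact FactorsThroughProp.sum _ fun i _ => (h _).precomp _

/-- The functor `B ↦ H_j(E; R ⊗[k] B)` on representations of `Γ`. -/
noncomputable abbrev twistedHomology (χ : E →* R) (q : E →* Γ) (j : ℕ) :
    Rep.{u} k Γ ⥤ ModuleCat.{u} R :=
  twistedFunctor χ q ⋙ groupHomology.functor R E j

variable (χ : E →* R) (q : E →* Γ)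

lemma twistedHomology_zero_epi [Module.Flat k R] {X : ShortComplex (Rep.{u} k Γ)}
    (hX : X.ShortExact) : Epi ((twistedHomology χ q 0).map X.g) := by
  have : Epi ((X.map (twistedFunctor χ q)).map (groupHomology.chainsFunctor R E)).g :=
    (groupHomology.map_chainsFunctor_shortExact (twistedFunctor_shortExact χ q hX)).epi_g
  have : Epi (((X.map (twistedFunctor χ q)).map (groupHomology.chainsFunctor R E)).g.f 0) :=
    inferInstance
  exact HomologicalComplex.epi_homologyMap_of_epi_of_not_rel
    ((X.map (twistedFunctor χ q)).map (groupHomology.chainsFunctor R E)).g 0 (by simp)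

lemma twistedHomology_exact [Module.Flat k R] {X : ShortComplex (Rep.{u} k Γ)}
    (hX : X.ShortExact) (j : ℕ) :
    ∃ (δ : (twistedHomology χ q (j + 1)).obj X.X₃ ⟶ (twistedHomology χ q j).obj X.X₁)
      (w : (twistedHomology χ q (j + 1)).map X.g ≫ δ = 0), (ShortComplex.mk _ _ w).Exact := by
  have h := twistedFunctor_shortExact χ q hX
  exact ⟨groupHomology.δ h (j + 1) j rfl, _, groupHomology.mapShortComplex₃_exact h rfl⟩

variable {χ q} (P : ObjectProperty (ModuleCat.{u} R)) [P.IsSerreClass]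

/-- The first syzygy of a partial resolution; in length zero nothing is known about it. -/
lemma HasFGPartialResolution.exists_shortExact {n : ℕ} {B : Rep.{u} k Γ}
    (hB : HasFGPartialResolution n B) :
    ∃ (K F : Rep.{u} k Γ) (ι : K ⟶ F) (π : F ⟶ B) (w : ι ≫ π = 0),
      (ShortComplex.mk ι π w).ShortExact ∧ IsFGProjective F ∧
        ∀ m, m + 1 = n → HasFGPartialResolution m K := by
  cases n with
  | zero =>
    obtain ⟨F, π, hF, hπ⟩ := hB
    exact ⟨_, F, kernel.ι π, π, kernel.condition π,
      ShortComplex.ShortExact.mk' (ShortComplex.exact_kernel π) inferInstance hπ, hF, by simp⟩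
  | succ n =>
    obtain ⟨K, F, ι, π, w, hX, hF, hK⟩ := hB
    exact ⟨K, F, ι, π, w, hX, hF, by rintro m ⟨rfl⟩; exact hK⟩

/-- One step of dimension shifting: `H_j(E; R ⊗ B)` lies in a Serre class if the maps into it
from `H_j(E; R ⊗ k[Γ])` have image in the class, and the homology of the first syzygy in degree
`j - 1` lies in the class. -/
lemma prop_twistedHomology_of_shortExact [Module.Flat k R] {K F B : Rep.{u} k Γ} {ι : K ⟶ F}
    {π : F ⟶ B} {w : ι ≫ π = 0} (hX : (ShortComplex.mk ι π w).ShortExact)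
    (hF : IsFGProjective F) (j : ℕ)
    (h : ∀ g : Rep.leftRegular k Γ ⟶ B, FactorsThroughProp P ((twistedHomology χ q j).map g))
    (hK : ∀ i, i + 1 = j → P ((twistedHomology χ q i).obj K)) :
    P ((twistedHomology χ q j).obj B) := by
  -- `H_j` of the projective term need not lie in the class, only its image in `H_j(E; R ⊗ B)`.
  have hπ := hF.factorsThroughProp_map P (twistedHomology χ q j) π h
  cases j with
  | zero =>
    have := twistedHomology_zero_epi χ q hX
    exact FactorsThroughProp.prop_of_epi _ hπ
  | succ j =>
    obtain ⟨δ, w, hδ⟩ := twistedHomology_exact χ q hX j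
    exact FactorsThroughProp.prop_of_exact hδ hπ (hK j rfl)

/-- Dimension shifting: if the values on `k[Γ]` lie in a Serre class up to degree `j`, so does the
value in degree `j` on any representation with a long enough partial resolution. -/
lemma HasFGPartialResolution.prop_twistedHomology [Module.Flat k R] (j : ℕ) :
    ∀ {n : ℕ} {B : Rep.{u} k Γ}, HasFGPartialResolution n B → j ≤ n →
      (∀ i ≤ j, P ((twistedHomology χ q i).obj (Rep.leftRegular k Γ))) →
      P ((twistedHomology χ q j).obj B) := by
  induction j with
  | zero =>
    intro n B hB _ h
    obtain ⟨K, F, ι, π, w, hX, hF, hK⟩ := hB.exists_shortExact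
    exact prop_twistedHomology_of_shortExact P hX hF 0
      (fun g => .of_prop_left _ (h 0 le_rfl)) (by simp)
  | succ j ih =>
    intro n B hB hj h
    obtain ⟨K, F, ι, π, w, hX, hF, hK⟩ := hB.exists_shortExact
    refine prop_twistedHomology_of_shortExact P hX hF _
      (fun g => .of_prop_left _ (h _ le_rfl)) ?_
    rintro i ⟨rfl⟩
    obtain ⟨m, rfl⟩ := Nat.exists_eq_add_of_lt (Nat.lt_of_succ_le hj)
    exact ih (hK (j + m) (by omega)) (by omega) fun i hi => h i (by omega)

/-- Dimension shifting in which only the image of `H_j(E; R ⊗ k[Γ])`, and not all of it, is known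
to lie in the Serre class in the top degree. -/
lemma HasFGPartialResolution.prop_twistedHomology_of_image [Module.Flat k R] {n j : ℕ}
    {B : Rep.{u} k Γ} (hB : HasFGPartialResolution n B) (hj : j ≤ n)
    (h : ∀ i < j, P ((twistedHomology χ q i).obj (Rep.leftRegular k Γ)))
    (hg : ∀ g : Rep.leftRegular k Γ ⟶ B, FactorsThroughProp P ((twistedHomology χ q j).map g)) :
    P ((twistedHomology χ q j).obj B) := by
  obtain ⟨K, F, ι, π, w, hX, hF, hK⟩ := hB.exists_shortExact
  refine prop_twistedHomology_of_shortExact P hX hF j hg ?_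
  rintro i rfl
  obtain ⟨m, rfl⟩ := Nat.exists_eq_add_of_lt (Nat.lt_of_succ_le hj)
  exact (hK (i + m) (by omega)).prop_twistedHomology P i (by omega) fun i hi => h i (by omega)

end DimensionShifting

/-! ### Centralising elements act trivially on homology -/

lemma HomologicalComplex.homologyMap_eq_id_of_iso {C ι : Type*} [Category C] [Preadditive C]
    [CategoryWithHomology C] {c : ComplexShape ι} {K L : HomologicalComplex C c} (α : K ≅ L)
    (f : K ⟶ K) (g : L ⟶ L) (h : f ≫ α.hom = α.hom ≫ g) (n : ι)
    (hg : HomologicalComplex.homologyMap g n = 𝟙 _) :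
    HomologicalComplex.homologyMap f n = 𝟙 _ := by
  rw [← Category.comp_id f, ← α.hom_inv_id, ← Category.assoc, h, Category.assoc,
    HomologicalComplex.homologyMap_comp, HomologicalComplex.homologyMap_comp,
    hg, Category.id_comp,
    ← HomologicalComplex.homologyMap_comp, α.hom_inv_id, HomologicalComplex.homologyMap_id]

section Shapiro

open Limits TensorProduct Representation

variable {R E : Type u} [CommRing R] [Group E]

/-- The comparison of inhomogeneous chains with the coinvariants of the bar resolution is natural
in the coefficients. -/
lemma groupHomology.inhomogeneousChainsIso_hom_naturality [DecidableEq E] {A B : Rep.{u} R E}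
    (f : A ⟶ B) :
    groupHomology.chainsMap (MonoidHom.id E) f ≫ (groupHomology.inhomogeneousChainsIso B).hom =
      (groupHomology.inhomogeneousChainsIso A).hom ≫
        (NatTrans.mapHomologicalComplex ((Rep.coinvariantsTensor R E).map f) _).app
          (Rep.barComplex R E) := by
  ext i x a
  simp only [groupHomology.inhomogeneousChainsIso]
  have hA := Rep.finsuppToCoinvariantsTensorFree_single (A := A) x a
  have hB := Rep.finsuppToCoinvariantsTensorFree_single (A := B) x (f.hom a)
  have hf := groupHomology.chainsMap_f_single (MonoidHom.id E) (A := A) (B := B) f i x a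
  refine ((congrArg (Rep.finsuppToCoinvariantsTensorFree B (Fin i → E)) hf).trans hB).trans
    (Eq.trans ?_ (congrArg (((Rep.coinvariantsTensor R E).map f).app
      (Rep.free R E (Fin i → E))).hom hA).symm)
  rfl

/-- An endomorphism of the coefficients acts as the identity on group homology if it does so on the
homology of the coinvariants of every projective resolution. Keeping the resolution arbitrary avoids
unfolding the bar resolution. -/
lemma groupHomology.map_eq_id_of_coinvariantsTensor {A : Rep.{u} R E} (f : A ⟶ A) (n : ℕ)
    (h : ∀ Q : ProjectiveResolution (Rep.trivial R E R), HomologicalComplex.homologyMap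
      ((NatTrans.mapHomologicalComplex ((Rep.coinvariantsTensor R E).map f)
        (ComplexShape.down ℕ)).app Q.complex) n = 𝟙 _) :
    (groupHomology.functor R E n).map f = 𝟙 _ := by
  classical
  exact HomologicalComplex.homologyMap_eq_id_of_iso (groupHomology.inhomogeneousChainsIso A) _ _
    (groupHomology.inhomogeneousChainsIso_hom_naturality f) n (h (Rep.barResolution R E))

variable {S : Subgroup E}

/-- The action of an element centralising `S`, as an endomorphism of the restriction functor
from `E` to `S`. -/
noncomputable def resAction (z : E) (hz : ∀ s ∈ S, s * z = z * s) :
    (Rep.resFunctor S.subtype : Rep.{u} R E ⥤ Rep.{u} R S) ⟶ Rep.resFunctor S.subtype where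
  app B := Rep.ofHom ⟨B.ρ z, fun s => by
    change B.ρ z ∘ₗ B.ρ s = B.ρ s ∘ₗ B.ρ z
    rw [← Module.End.mul_eq_comp, ← Module.End.mul_eq_comp, ← map_mul, ← map_mul, hz s s.2]⟩
  naturality B C f := by
    ext x
    exact (Rep.hom_comm_apply f z x).symm

lemma Representation.IndV.mk_rho {V : Type*} [AddCommGroup V] [Module R V]
    (ρ : Representation R S V) (h : E) (s : S) (a : V) :
    IndV.mk S.subtype ρ h (ρ s a) = IndV.mk S.subtype ρ (s⁻¹ * h) a := by
  have h := Coinvariants.mk_inv_tmul (ρ := (leftRegular R E).comp S.subtype) (τ := ρ)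
    (MonoidAlgebra.single h 1) a s
  simpa using h.symm

lemma Rep.indResHomEquiv_symm_hom_mk {A : Rep.{u} R S} {B : Rep.{u} R E}
    (f : A ⟶ Rep.res S.subtype B) (h : E) (a : A) :
    ((Rep.indResHomEquiv S.subtype A B).symm f).hom (IndV.mk S.subtype A.ρ h a) =
      B.ρ h⁻¹ (f.hom a) := by
  simp [Rep.indResHomEquiv]

/-- The endomorphism `⟦h ⊗ a⟧ ↦ ⟦z h ⊗ a⟧` of an induced representation, for `z` centralising the
subgroup from which one induces. -/
noncomputable def indTranslate (z : E) (hz : ∀ s ∈ S, s * z = z * s) (A : Rep.{u} R S) :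
    Rep.ind S.subtype A ⟶ Rep.ind S.subtype A :=
  (Rep.indResHomEquiv S.subtype A (Rep.ind S.subtype A)).symm
    (Rep.ofHom ⟨IndV.mk S.subtype A.ρ z, fun s => by
      refine LinearMap.ext fun (a : A) => ?_
      change IndV.mk S.subtype A.ρ z (A.ρ s a) =
        Representation.ind S.subtype A.ρ s (IndV.mk S.subtype A.ρ z a)
      rw [Representation.ind_mk, IndV.mk_rho, ← hz _ (S.inv_mem s.2)]
      rfl⟩)

lemma indTranslate_mk (z : E) (hz : ∀ s ∈ S, s * z = z * s) (A : Rep.{u} R S) (h : E) (a : A) :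
    (indTranslate z hz A).hom (IndV.mk S.subtype A.ρ h a) = IndV.mk S.subtype A.ρ (z * h) a := by
  simp [indTranslate, Rep.indResHomEquiv]

/-- Under the isomorphism `(Ind A ⊗ B)_E ≅ (A ⊗ Res B)_S`, translation by `z` on the induced
representation becomes the action of `z` on `B`. -/
lemma indTranslate_comp_coinvariantsTensorIndIso_hom (z : E) (hz : ∀ s ∈ S, s * z = z * s)
    (A : Rep.{u} R S) (B : Rep.{u} R E) :
    ((Rep.coinvariantsTensor R E).map (indTranslate z hz A)).app B ≫
        (Rep.coinvariantsTensorIndIso S.subtype A B).hom =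
      (Rep.coinvariantsTensorIndIso S.subtype A B).hom ≫
        ((Rep.coinvariantsTensor R S).obj A).map ((resAction z hz).app B) := by
  ext h a b
  have h1 := Rep.coinvariantsTensorIndHom_mk_tmul_indVMk S.subtype (z * h) a b
  have h2 := Rep.coinvariantsTensorIndHom_mk_tmul_indVMk S.subtype h a b
  have h3 := indTranslate_mk z hz A h a
  have h4 := congrArg (fun t => (Rep.coinvariantsTensorIndHom S.subtype A B).hom
    (Rep.coinvariantsTensorMk _ _ t b)) h3
  refine (h4.trans h1).trans (Eq.trans ?_
    (congrArg (((Rep.coinvariantsTensor R S).obj A).map ((resAction z hz).app B)).hom h2).symm)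
  rw [map_mul]
  rfl

/-- On the restriction of a projective resolution of the trivial representation, an element
centralising the subgroup acts by a map homotopic to the identity, since it lifts the identity. -/
lemma nonempty_homotopy_resAction (z : E) (hz : ∀ s ∈ S, s * z = z * s)
    (Q : ProjectiveResolution (Rep.trivial R E R)) :
    Nonempty (Homotopy ((NatTrans.mapHomologicalComplex (resAction (R := R) z hz)
      (ComplexShape.down ℕ)).app Q.complex) (𝟙 _)) := by
  refine ⟨ProjectiveResolution.liftHomotopy
    (P := (Rep.resFunctor.{u} S.subtype).mapProjectiveResolution Q)
    (Q := (Rep.resFunctor.{u} S.subtype).mapProjectiveResolution Q) (𝟙 _) _ _ ?_ ?_⟩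
  · refine HomologicalComplex.to_single_hom_ext ?_
    have h : (resAction (R := R) z hz).app (Q.complex.X 0) ≫
        (Rep.resFunctor S.subtype).map (Q.π.f 0) = (Rep.resFunctor S.subtype).map (Q.π.f 0) := by
      ext x
      exact Rep.hom_comm_apply (Q.π.f 0) z x
    have h' : ((NatTrans.mapHomologicalComplex (resAction (R := R) z hz)
        (ComplexShape.down ℕ)).app Q.complex ≫
          ((Rep.resFunctor S.subtype).mapHomologicalComplex _).map Q.π).f 0 =
        (((Rep.resFunctor S.subtype).mapHomologicalComplex _).map Q.π).f 0 := h
    rw [CategoryTheory.Functor.map_id, Category.comp_id]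
    exact (Category.assoc _ _ _).symm.trans (congrArg (· ≫
      ((HomologicalComplex.singleMapHomologicalComplex (Rep.resFunctor S.subtype)
        (ComplexShape.down ℕ) 0).hom.app (Rep.trivial R E R)).f 0) h')
  · exact (Category.id_comp _).trans
      ((Category.comp_id _).symm.trans (congrArg _ (CategoryTheory.Functor.map_id _ _).symm))

/-- Translation by `z` on `Ind A` is, up to isomorphism, induced by a map homotopic to the identity
on the restricted resolution. -/
lemma homologyMap_indTranslate_coinvariantsTensor (z : E) (hz : ∀ s ∈ S, s * z = z * s)
    (A : Rep.{u} R S) (Q : ProjectiveResolution (Rep.trivial R E R)) (n : ℕ) :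
    HomologicalComplex.homologyMap ((NatTrans.mapHomologicalComplex
      ((Rep.coinvariantsTensor R E).map (indTranslate z hz A)) (ComplexShape.down ℕ)).app
        Q.complex) n = 𝟙 _ := by
  obtain ⟨H⟩ := nonempty_homotopy_resAction (R := R) z hz Q
  let α := (NatIso.mapHomologicalComplex (Rep.coinvariantsTensorIndNatIso S.subtype A)
    (ComplexShape.down ℕ)).app Q.complex
  refine HomologicalComplex.homologyMap_eq_id_of_iso α _ _ ?_ n
    (((((Rep.coinvariantsTensor R S).obj A).mapHomotopy H).homologyMap_eq n).trans ?_)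
  · ext1 i
    exact indTranslate_comp_coinvariantsTensorIndIso_hom z hz A (Q.complex.X i)
  · rw [CategoryTheory.Functor.map_id]
    exact HomologicalComplex.homologyMap_id _ _

/-- Translation by an element centralising `S` acts as the identity on the homology of a
representation induced from `S`. -/
lemma groupHomology.map_indTranslate (z : E) (hz : ∀ s ∈ S, s * z = z * s)
    (A : Rep.{u} R S) (n : ℕ) :
    (groupHomology.functor R E n).map (indTranslate z hz A) = 𝟙 _ := by
  exact groupHomology.map_eq_id_of_coinvariantsTensor _ n fun Q =>
    homologyMap_indTranslate_coinvariantsTensor z hz A Q n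

end Shapiro

/-! ### The twisted group algebra as an induced representation -/

section InducedTwisted

open TensorProduct Representation

variable {k R Γ E : Type u} [CommRing k] [CommRing R] [Algebra k R] [Group Γ] [Group E]

/-- The embedding `r ↦ r ⊗ 1` of `R` into `R ⊗[k] k[Γ]`, which is equivariant for the kernel
of `q`. -/
noncomputable def charToTwisted (k : Type u) {R Γ E : Type u} [CommRing k] [CommRing R]
    [Algebra k R] [Group Γ] [Group E] (χ : E →* R) (q : E →* Γ) :
    charRep (χ.comp q.ker.subtype) ⟶
      Rep.res q.ker.subtype ((twistedFunctor χ q).obj (Rep.leftRegular k Γ)) :=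
  Rep.ofHom ⟨(TensorProduct.AlgebraTensorModule.mk k R R k[Γ]).flip (.single 1 1), fun s => by
    have hs : q s = 1 := s.2
    refine LinearMap.ext fun (r : R) => ?_
    have h := twistedRep_ρ_tmul χ q (Rep.leftRegular k Γ) s r (.single 1 1)
    rw [hs, map_one] at h
    exact h.symm⟩

/-- The comparison map from the representation induced from the kernel of `q` to
`R ⊗[k] k[Γ]`. -/
noncomputable def indToTwisted (χ : E →* R) (q : E →* Γ) :
    Rep.ind q.ker.subtype (charRep (χ.comp q.ker.subtype)) ⟶
      (twistedFunctor χ q).obj (Rep.leftRegular k Γ) :=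
  (Rep.indResHomEquiv q.ker.subtype (charRep (χ.comp q.ker.subtype))
    ((twistedFunctor χ q).obj (Rep.leftRegular k Γ))).symm (charToTwisted k χ q)

lemma indToTwisted_mk (χ : E →* R) (q : E →* Γ) (h : E) (a : R) :
    (indToTwisted (k := k) χ q).hom
      (IndV.mk q.ker.subtype (charRep (χ.comp q.ker.subtype)).ρ h a) =
      (χ h⁻¹ * a) ⊗ₜ[k] (MonoidAlgebra.single (q h)⁻¹ 1 : k[Γ]) := by
  have h1 := twistedRep_ρ_tmul χ q (Rep.leftRegular k Γ) h⁻¹ a (.single 1 1)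
  refine (Rep.indResHomEquiv_symm_hom_mk (charToTwisted k χ q) h a).trans (h1.trans ?_)
  simp

/-- Inducing the character `χ` from `ker q` gives `R ⊗[k] k[Γ]`. -/
lemma indToTwisted_bijective (χ : E →* R) (q : E →* Γ) (hq : Function.Surjective q) :
    Function.Bijective (indToTwisted (k := k) χ q).hom := by
  classical
  let s := Function.surjInv hq
  have hs : ∀ γ, q (s γ) = γ := Function.surjInv_eq hq
  let A := charRep (χ.comp q.ker.subtype)
  -- The inverse sends `r ⊗ γ` to the class of `(s γ)⁻¹ ⊗ χ (s γ)⁻¹ r`; the inverses come from the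
  -- right translation action used in `Rep.ind`.
  let inv : R ⊗[k] k[Γ] →ₗ[R] Rep.ind q.ker.subtype A :=
    (Finsupp.lsum R fun γ => IndV.mk q.ker.subtype A.ρ (s γ)⁻¹ ∘ₗ (χ (s γ)⁻¹ • LinearMap.id)) ∘ₗ
      (TensorProduct.finsuppScalarRight k R R Γ).toLinearMap ∘ₗ
      (MonoidAlgebra.coeffLinearEquiv k).toLinearMap.baseChange R
  have hinv : ∀ (r : R) (γ : Γ), inv (r ⊗ₜ[k] .single γ 1) =
      IndV.mk q.ker.subtype A.ρ (s γ)⁻¹ (χ (s γ)⁻¹ * r) := by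
    intro r γ
    have h : TensorProduct.finsuppScalarRight k R R Γ (r ⊗ₜ[k] Finsupp.single γ 1) =
        Finsupp.single γ r := by
      simp [TensorProduct.finsuppScalarRight_apply_tmul]
    simp [inv, h]
  refine ⟨Function.LeftInverse.injective (g := inv) ?_, fun x => ?_⟩
  · refine LinearMap.congr_fun (f := inv ∘ₗ (indToTwisted (k := k) χ q).hom.toLinearMap)
      (g := LinearMap.id) (IndV.hom_ext _ _ fun h => LinearMap.ext fun (a : R) => ?_)
    refine (congrArg inv (indToTwisted_mk χ q h a)).trans ((hinv _ _).trans ?_)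
    have ht : h * s (q h)⁻¹ ∈ q.ker := by simp [MonoidHom.mem_ker, hs]
    have hA : (χ (s (q h)⁻¹)⁻¹ * (χ h⁻¹ * a) : R) = A.ρ ⟨_, ht⟩⁻¹ a := by
      change _ = χ (h * s (q h)⁻¹)⁻¹ * a
      rw [mul_inv_rev, map_mul, mul_assoc]
    rw [hA, IndV.mk_rho]
    simp
    rfl
  · change R ⊗[k] k[Γ] at x
    induction x using TensorProduct.induction_on with
    | zero => exact ⟨0, map_zero _⟩
    | add x y hx hy =>
      obtain ⟨x', hx⟩ := hx
      obtain ⟨y', hy⟩ := hy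
      exact ⟨x' + y', by rw [map_add, hx, hy]; rfl⟩
    | tmul r x =>
      induction x using MonoidAlgebra.induction_linear with
      | zero => exact ⟨0, by rw [map_zero, tmul_zero]; rfl⟩
      | add x y hx hy =>
        obtain ⟨x', hx⟩ := hx
        obtain ⟨y', hy⟩ := hy
        exact ⟨x' + y', by rw [map_add, hx, hy, tmul_add]; rfl⟩
      | single γ c =>
        refine ⟨IndV.mk q.ker.subtype A.ρ (s γ)⁻¹ (χ (s γ)⁻¹ * (c • r)),
          (indToTwisted_mk χ q _ _).trans ?_⟩
        rw [← mul_assoc, ← map_mul, map_inv, inv_inv, hs, inv_inv, mul_inv_cancel, map_one,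
          one_mul, TensorProduct.smul_tmul, MonoidAlgebra.smul_single, smul_eq_mul, mul_one]

/-- Right multiplication by `γ` on `k[Γ]`. -/
noncomputable abbrev rightMulHom (k : Type u) {Γ : Type u} [CommRing k] [Group Γ] (γ : Γ) :
    Rep.leftRegular k Γ ⟶ Rep.leftRegular k Γ :=
  Rep.leftRegularHom _ (MonoidAlgebra.single γ 1)

/-- Translation by `z⁻¹` on the induced representation corresponds to `χ z` times right
multiplication by `q z` on `R ⊗[k] k[Γ]`. -/
lemma indTranslate_comp_indToTwisted (χ : E →* R) (q : E →* Γ) (z : E)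
    (hz : ∀ s ∈ q.ker, s * z⁻¹ = z⁻¹ * s) :
    indTranslate z⁻¹ hz (charRep (χ.comp q.ker.subtype)) ≫ indToTwisted (k := k) χ q =
      indToTwisted (k := k) χ q ≫ (χ z • (twistedFunctor χ q).map (rightMulHom k (q z))) := by
  refine Rep.hom_ext (Representation.IntertwiningMap.ext (IndV.hom_ext _ _ fun h => ?_))
  refine LinearMap.ext fun (a : R) => ?_
  have h1 := indTranslate_mk z⁻¹ hz (charRep (χ.comp q.ker.subtype)) h a
  have h2 := indToTwisted_mk (k := k) χ q (z⁻¹ * h) a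
  have h3 := indToTwisted_mk (k := k) χ q h a
  have h4 := congrArg (χ z • (twistedFunctor χ q).map (rightMulHom k (q z))).hom h3
  refine ((congrArg (indToTwisted (k := k) χ q).hom h1).trans h2).trans (Eq.trans ?_ h4.symm)
  change _ = χ z • ((χ h⁻¹ * a) ⊗ₜ[k] (rightMulHom k (q z)).hom (.single (q h)⁻¹ 1))
  rw [Rep.leftRegularHom_hom_single, TensorProduct.smul_tmul']
  simp [mul_comm, mul_left_comm]

end InducedTwisted

/-! ### Serre classes of finitely generated modules, and the action of central elements -/

section SerreClasses

open Limits TensorProduct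

/-- The noetherian modules over `R`. -/
def noetherianModules (R : Type u) [CommRing R] : ObjectProperty (ModuleCat.{u} R) :=
  fun M => IsNoetherian R M

/-- The `R`-modules whose underlying abelian group is finitely generated, that is, noetherian. -/
def intNoetherianModules (R : Type u) [CommRing R] : ObjectProperty (ModuleCat.{u} R) :=
  fun M => IsNoetherian ℤ M

instance noetherianModules_isSerreClass (R : Type u) [CommRing R] :
    (noetherianModules R).IsSerreClass where
  exists_zero := ⟨ModuleCat.of R PUnit, ModuleCat.isZero_of_subsingleton _,
    inferInstanceAs (IsNoetherian R PUnit.{u + 1})⟩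
  prop_of_mono f _ h := by
    have : IsNoetherian R _ := h
    exact isNoetherian_of_injective f.hom ((ModuleCat.mono_iff_injective f).1 inferInstance)
  prop_of_epi f _ h := by
    have : IsNoetherian R _ := h
    exact isNoetherian_of_surjective f.hom
      (LinearMap.range_eq_top.2 ((ModuleCat.epi_iff_surjective f).1 inferInstance))
  prop_X₂_of_shortExact {S} hS h₁ h₃ := by
    have : IsNoetherian R S.X₁ := h₁
    have : IsNoetherian R S.X₃ := h₃
    exact isNoetherian_of_range_eq_ker S.f.hom S.g.hom hS.exact.moduleCat_range_eq_ker

instance intNoetherianModules_isSerreClass (R : Type u) [CommRing R] :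
    (intNoetherianModules R).IsSerreClass where
  exists_zero := ⟨ModuleCat.of R PUnit, ModuleCat.isZero_of_subsingleton _,
    inferInstanceAs (IsNoetherian ℤ PUnit.{u + 1})⟩
  prop_of_mono f _ h := by
    have : IsNoetherian ℤ _ := h
    exact isNoetherian_of_injective f.hom.toAddMonoidHom.toIntLinearMap
      ((ModuleCat.mono_iff_injective f).1 inferInstance)
  prop_of_epi f _ h := by
    have : IsNoetherian ℤ _ := h
    exact isNoetherian_of_surjective f.hom.toAddMonoidHom.toIntLinearMap
      (LinearMap.range_eq_top.2 ((ModuleCat.epi_iff_surjective f).1 inferInstance))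
  prop_X₂_of_shortExact {S} hS h₁ h₃ := by
    have : IsNoetherian ℤ S.X₁ := h₁
    have : IsNoetherian ℤ S.X₃ := h₃
    refine isNoetherian_of_range_eq_ker S.f.hom.toAddMonoidHom.toIntLinearMap
      S.g.hom.toAddMonoidHom.toIntLinearMap ?_
    ext x
    exact SetLike.ext_iff.1 hS.exact.moduleCat_range_eq_ker x

/-- A noetherian `R`-module killed by `c`, where `R / c` is finitely generated as an abelian group,
is finitely generated as an abelian group. -/
lemma intNoetherian_of_smul_eq_zero {R M : Type*} [CommRing R] [AddCommGroup M] [Module R M]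
    [Module.Finite R M] (c : R) [Module.Finite ℤ (R ⧸ Ideal.span {c})] (h : ∀ x : M, c • x = 0) :
    IsNoetherian ℤ M := by
  have hM : Module.IsTorsionBySet R M (Ideal.span {c} : Ideal R) :=
    (Module.isTorsionBySet_span_singleton_iff c).2 fun x => h x
  let _ := hM.module
  have : IsScalarTower R (R ⧸ Ideal.span {c}) M := hM.isScalarTower
  have : Module.Finite (R ⧸ Ideal.span {c}) M := Module.Finite.of_restrictScalars_finite R _ M
  have : Module.Finite ℤ M := Module.Finite.trans (R ⧸ Ideal.span {c}) M
  exact isNoetherian_of_isNoetherianRing_of_finite ℤ M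

end SerreClasses

section ProductStep

open Limits TensorProduct

variable {k R Γ E : Type u} [CommRing k] [CommRing R] [Algebra k R] [Group Γ] [Group E]

/-- Shapiro's lemma for `R ⊗[k] k[Γ]`. -/
lemma nonempty_twistedHomology_leftRegular_iso (χ : E →* R) (q : E →* Γ)
    (hq : Function.Surjective q) (j : ℕ) :
    Nonempty ((twistedHomology χ q j).obj (Rep.leftRegular k Γ) ≅
      groupHomology (charRep (χ.comp q.ker.subtype)) j) := by
  classical
  have : IsIso (indToTwisted (k := k) χ q) := by
    have := (Rep.mono_iff_injective _).2 (indToTwisted_bijective (k := k) χ q hq).1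
    have := (Rep.epi_iff_surjective _).2 (indToTwisted_bijective (k := k) χ q hq).2
    exact isIso_of_mono_of_epi _
  exact ⟨(groupHomology.functor R E j).mapIso (asIso (indToTwisted (k := k) χ q)).symm ≪≫
    groupHomology.indIso q.ker _ j⟩

lemma HomologicalComplex.homologyMap_smul {R : Type*} [CommRing R] {C ι : Type*} [Category C]
    [Preadditive C] [Linear R C] {c : ComplexShape ι} {K L : HomologicalComplex C c} (r : R)
    (f : K ⟶ L) (i : ι) [K.HasHomology i] [L.HasHomology i] :
    homologyMap (r • f) i = r • homologyMap f i :=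
  ShortComplex.homologyMap_smul ((shortComplexFunctor C c i).map f) r

lemma groupHomology.functor_map_smul {A B : Rep.{u} R E} (f : A ⟶ B) (r : R) (n : ℕ) :
    (groupHomology.functor R E n).map (r • f) = r • (groupHomology.functor R E n).map f := by
  have h : (groupHomology.chainsFunctor R E).map (r • f) =
      r • (groupHomology.chainsFunctor R E).map f := by
    refine HomologicalComplex.hom_ext _ _ fun i => ModuleCat.hom_ext ?_
    refine Finsupp.lhom_ext fun x a => ?_
    change ((groupHomology.chainsMap (MonoidHom.id E) (r • f)).f i).hom _ =
      r • ((groupHomology.chainsMap (MonoidHom.id E) f).f i).hom _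
    simp only [groupHomology.chainsMap_id_f_hom_eq_mapRange]
    simp [Rep.smul_hom]
  refine (congrArg (HomologicalComplex.homologyMap · n) h).trans ?_
  exact HomologicalComplex.homologyMap_smul r _ n

/-- If `z` centralises the kernel of `q`, then `χ z - 1` kills the image of
`H_j(E; R ⊗ k[Γ])` under any map induced by a map from `k[Γ]` to the trivial representation. -/
lemma smul_twistedHomology_map_eq (χ : E →* R) (q : E →* Γ)
    (hq : Function.Surjective q) (z : E) (hz : ∀ s ∈ q.ker, s * z = z * s) (j : ℕ)
    (g : Rep.leftRegular k Γ ⟶ Rep.trivial k Γ k) :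
    χ z • (twistedHomology χ q j).map g = (twistedHomology χ q j).map g := by
  have hz' : ∀ s ∈ q.ker, s * z⁻¹ = z⁻¹ * s := fun s hs => by
    rw [eq_inv_mul_iff_mul_eq, ← mul_assoc, ← hz s hs, mul_inv_cancel_right]
  have : Epi (indToTwisted (k := k) χ q) :=
    (Rep.epi_iff_surjective _).2 (indToTwisted_bijective (k := k) χ q hq).2
  have : Mono (indToTwisted (k := k) χ q) :=
    (Rep.mono_iff_injective _).2 (indToTwisted_bijective (k := k) χ q hq).1
  have : IsIso (indToTwisted (k := k) χ q) := isIso_of_mono_of_epi _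
  have h1 := congrArg (groupHomology.functor R E j).map
    (indTranslate_comp_indToTwisted (k := k) χ q z hz')
  rw [Functor.map_comp, groupHomology.map_indTranslate, Category.id_comp, Functor.map_comp,
    groupHomology.functor_map_smul] at h1
  have h2 : χ z • (groupHomology.functor R E j).map
      ((twistedFunctor χ q).map (rightMulHom k (q z))) = 𝟙 _ := by
    rw [← cancel_epi ((groupHomology.functor R E j).map (indToTwisted (k := k) χ q)), ← h1]
    exact (Category.comp_id _).symm
  -- A map from `k[Γ]` to a trivial representation does not see right multiplication.
  have h3 : rightMulHom k (q z) ≫ g = g := by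
    refine (Rep.leftRegularHomEquiv _).injective ?_
    change g.hom ((rightMulHom k (q z)).hom (.single 1 1)) = g.hom (.single 1 1)
    rw [Rep.leftRegularHom_hom_single]
    have h := Rep.hom_comm_apply g (q z) (.single 1 1)
    simpa using h
  calc χ z • (twistedHomology χ q j).map g
      = χ z • (twistedHomology χ q j).map (rightMulHom k (q z) ≫ g) := by rw [h3]
    _ = (χ z • (twistedHomology χ q j).map (rightMulHom k (q z))) ≫
          (twistedHomology χ q j).map g := by
        rw [Functor.map_comp, Linear.smul_comp]
    _ = (twistedHomology χ q j).map g := by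
        refine (congrArg (· ≫ (twistedHomology χ q j).map g) h2).trans ?_
        exact Category.id_comp _

/-- The image of `H_j(E; R ⊗ k[Γ])` in `H_j(E; R_χ)` is finitely generated over `ℤ`, although the
source need only be finitely generated over `R`. -/
lemma factorsThroughProp_twistedHomology_map [IsNoetherianRing R] (χ : E →* R) (q : E →* Γ)
    (hq : Function.Surjective q) (z : E) (hz : ∀ s ∈ q.ker, s * z = z * s) (j : ℕ)
    [Module.Finite ℤ (R ⧸ Ideal.span {χ z - 1})]
    (hj : Module.Finite R ((twistedHomology χ q j).obj (Rep.leftRegular k Γ)))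
    (g : Rep.leftRegular k Γ ⟶ Rep.trivial k Γ k) :
    FactorsThroughProp (intNoetherianModules R) ((twistedHomology χ q j).map g) := by
  let f := ((twistedHomology χ q j).map g).hom
  refine ⟨ModuleCat.of R (LinearMap.range f), ModuleCat.ofHom f.rangeRestrict,
    ModuleCat.ofHom (LinearMap.range f).subtype, ?_, rfl⟩
  refine intNoetherian_of_smul_eq_zero (χ z - 1) ?_
  rintro ⟨_, x, rfl⟩
  have h := congrArg (fun t => t.hom x) (smul_twistedHomology_map_eq χ q hq z hz j g)
  refine Subtype.ext ?_
  rw [sub_smul, one_smul]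
  exact sub_eq_zero.2 h

end ProductStep

/-! ### Direct products -/

section Products

open Limits TensorProduct

variable {k R : Type u} [CommRing k] [CommRing R] [Algebra k R]

lemma nonempty_groupHomology_charRep_iso {G H : Type u} [Group G] [Group H] (e : G ≃* H)
    (χ : H →* R) (j : ℕ) :
    Nonempty (groupHomology (charRep (χ.comp e.toMonoidHom)) j ≅ groupHomology (charRep χ) j) :=
  ⟨groupHomology.mapIso (A := charRep (χ.comp e.toMonoidHom)) (B := charRep χ) e
    (LinearEquiv.refl R R) (fun _ => rfl) j⟩

/-- The kernel of the projection `Γ × G → Γ` is a copy of `G`. -/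
def kerFstEquiv (Γ G : Type*) [Group Γ] [Group G] : G ≃* (MonoidHom.fst Γ G).ker where
  toFun g := ⟨(1, g), rfl⟩
  invFun s := s.1.2
  left_inv _ := rfl
  right_inv s := Subtype.ext (Prod.ext (Eq.symm s.2) rfl)
  map_mul' _ _ := Subtype.ext (Prod.ext (one_mul 1).symm rfl)

variable {Γ G : Type u} [Group Γ] [Group G]

lemma nonempty_twistedHomology_fst_iso (χ : Γ × G →* R) (j : ℕ) :
    Nonempty ((twistedHomology χ (MonoidHom.fst Γ G) j).obj (Rep.leftRegular k Γ) ≅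
      groupHomology (charRep (χ.comp (MonoidHom.inr Γ G))) j) := by
  obtain ⟨e⟩ := nonempty_twistedHomology_leftRegular_iso (k := k) χ (MonoidHom.fst Γ G)
    Prod.fst_surjective j
  obtain ⟨e'⟩ := nonempty_groupHomology_charRep_iso (kerFstEquiv Γ G)
    (χ.comp (MonoidHom.fst Γ G).ker.subtype) j
  exact ⟨e ≪≫ e'.symm⟩

lemma nonempty_twistedHomology_trivial_iso (χ : Γ × G →* R) (j : ℕ) :
    Nonempty ((twistedHomology χ (MonoidHom.fst Γ G) j).obj (Rep.trivial k Γ k) ≅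
      groupHomology (charRep χ) j) :=
  ⟨(groupHomology.functor R _ j).mapIso (twistedTrivialIso χ _)⟩

/-- Finite generation over `R` passes from the homology of `G` to that of `Γ × G`. -/
lemma isNoetherian_groupHomology_prod [Module.Flat k R] {n : ℕ}
    (hΓ : HasFGPartialResolution n (Rep.trivial k Γ k)) (χ : Γ × G →* R) {j : ℕ} (hj : j ≤ n)
    (h : ∀ i ≤ j, IsNoetherian R (groupHomology (charRep (χ.comp (MonoidHom.inr Γ G))) i)) :
    IsNoetherian R (groupHomology (charRep χ) j) := by
  obtain ⟨e⟩ := nonempty_twistedHomology_trivial_iso (k := k) χ j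
  refine (noetherianModules R).prop_of_iso e
    (hΓ.prop_twistedHomology (noetherianModules R) j hj fun i hi => ?_)
  obtain ⟨e'⟩ := nonempty_twistedHomology_fst_iso (k := k) χ i
  exact (noetherianModules R).prop_of_iso e'.symm (h i hi)

/-- Finite generation over `ℤ` gains one degree when passing from the homology of `G` to that of
`Γ × G`. -/
lemma isNoetherian_int_groupHomology_prod [Module.Flat k R] [IsNoetherianRing R] {n : ℕ}
    (hΓ : HasFGPartialResolution n (Rep.trivial k Γ k)) (χ : Γ × G →* R) (γ : Γ)
    [Module.Finite ℤ (R ⧸ Ideal.span {χ (γ, 1) - 1})] {j : ℕ} (hj : j ≤ n)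
    (h : ∀ i < j, IsNoetherian ℤ (groupHomology (charRep (χ.comp (MonoidHom.inr Γ G))) i))
    (hR : IsNoetherian R (groupHomology (charRep (χ.comp (MonoidHom.inr Γ G))) j)) :
    IsNoetherian ℤ (groupHomology (charRep χ) j) := by
  obtain ⟨e⟩ := nonempty_twistedHomology_trivial_iso (k := k) χ j
  refine (intNoetherianModules R).prop_of_iso e
    (hΓ.prop_twistedHomology_of_image (intNoetherianModules R) hj (fun i hi => ?_) fun g => ?_)
  · obtain ⟨e'⟩ := nonempty_twistedHomology_fst_iso (k := k) χ i
    exact (intNoetherianModules R).prop_of_iso e'.symm (h i hi)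
  · obtain ⟨e'⟩ := nonempty_twistedHomology_fst_iso (k := k) χ j
    have : IsNoetherian R ((twistedHomology χ (MonoidHom.fst Γ G) j).obj (Rep.leftRegular k Γ)) :=
      (noetherianModules R).prop_of_iso e'.symm hR
    refine factorsThroughProp_twistedHomology_map χ (MonoidHom.fst Γ G) Prod.fst_surjective (γ, 1)
      (fun s hs => ?_) j inferInstance g
    have hs : s.1 = 1 := hs
    ext <;> simp [hs]

/-- A group family indexed by `Fin (m + 1)`, split into its head and its tail. -/
def headTailEquiv {m : ℕ} (Γ : Fin (m + 1) → Type*) [∀ i, Group (Γ i)] :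
    Γ 0 × (∀ i : Fin m, Γ i.succ) ≃* ∀ i, Γ i where
  __ := Fin.consEquiv Γ
  map_mul' _ _ := by
    funext i
    refine Fin.cases ?_ (fun i => ?_) i <;> simp [Fin.consEquiv]

lemma isNoetherian_groupHomology_of_subsingleton [IsNoetherianRing R] [Subsingleton G]
    (χ : G →* R) (j : ℕ) : IsNoetherian R (groupHomology (charRep χ) j) := by
  cases j with
  | zero =>
    exact (noetherianModules R).prop_of_epi (groupHomology.H0π (charRep χ))
      (inferInstanceAs (IsNoetherian R R))
  | succ j =>
    exact (noetherianModules R).prop_of_isZero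
      (isZero_groupHomology_succ_of_subsingleton _ _)

lemma isNoetherian_groupHomology_pi [Module.Flat k R] [IsNoetherianRing R] {n : ℕ} :
    ∀ {m : ℕ} (Γ : Fin m → Type u) [∀ i, Group (Γ i)]
      (_ : ∀ i, HasFGPartialResolution n (Rep.trivial k (Γ i) k)) (χ : (∀ i, Γ i) →* R)
      (j : ℕ) (_ : j ≤ n), IsNoetherian R (groupHomology (charRep χ) j) := by
  intro m
  induction m with
  | zero =>
    intro Γ _ hΓ χ j hj
    exact isNoetherian_groupHomology_of_subsingleton χ j
  | succ m ih =>
    intro Γ _ hΓ χ j hj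
    obtain ⟨e⟩ := nonempty_groupHomology_charRep_iso (headTailEquiv Γ) χ j
    refine (noetherianModules R).prop_of_iso e ?_
    exact isNoetherian_groupHomology_prod (hΓ 0) _ hj fun i hi =>
      ih (fun i => Γ i.succ) (fun i => hΓ i.succ) _ i (hi.trans hj)

/-- With `m` factors, on each of which `χ` takes a value `c` with `R / (c - 1)` finite over `ℤ`, the
homology is finitely generated over `ℤ` in degrees below `m`. -/
lemma isNoetherian_int_groupHomology_pi [Module.Flat k R] [IsNoetherianRing R] {n : ℕ} :
    ∀ {m : ℕ} (Γ : Fin m → Type u) [∀ i, Group (Γ i)]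
      (_ : ∀ i, HasFGPartialResolution n (Rep.trivial k (Γ i) k)) (χ : (∀ i, Γ i) →* R)
      (_ : ∀ i, ∃ γ, Module.Finite ℤ (R ⧸ Ideal.span {χ (MonoidHom.mulSingle Γ i γ) - 1}))
      (j : ℕ) (_ : j ≤ n) (_ : j < m), IsNoetherian ℤ (groupHomology (charRep χ) j) := by
  intro m
  induction m with
  | zero => intro Γ _ hΓ χ hχ j hj hm; omega
  | succ m ih =>
    intro Γ _ hΓ χ hχ j hj hm
    obtain ⟨e⟩ := nonempty_groupHomology_charRep_iso (headTailEquiv Γ) χ j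
    refine (intNoetherianModules R).prop_of_iso e ?_
    obtain ⟨γ, hγ⟩ := hχ 0
    have h0 : headTailEquiv Γ (γ, 1) = MonoidHom.mulSingle Γ 0 γ := by
      funext i
      refine Fin.cases ?_ (fun i => ?_) i
      · simp [headTailEquiv, Fin.consEquiv]
      · simp [headTailEquiv, Fin.consEquiv]
    have hs : ∀ (i : Fin m) (γ : Γ i.succ), headTailEquiv Γ
        (1, MonoidHom.mulSingle (fun i : Fin m => Γ i.succ) i γ) =
          MonoidHom.mulSingle Γ i.succ γ := by
      intro i γ
      funext l
      refine Fin.cases ?_ (fun l => ?_) l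
      · simp [headTailEquiv, Fin.consEquiv]
      · by_cases h : l = i
        · subst h
          simp [headTailEquiv, Fin.consEquiv]
        · simp [headTailEquiv, Fin.consEquiv, h]
    rw [← h0] at hγ
    have hγ' : Module.Finite ℤ
      (R ⧸ Ideal.span {(χ.comp (headTailEquiv Γ).toMonoidHom) (γ, 1) - 1}) := hγ
    refine isNoetherian_int_groupHomology_prod (k := k) (hΓ 0) _ γ hj (fun i hi => ?_) ?_
    · refine ih (fun i => Γ i.succ) (fun i => hΓ i.succ) _ (fun l => ?_) i (by omega) (by omega)
      obtain ⟨γ, hγ⟩ := hχ l.succ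
      refine ⟨γ, ?_⟩
      rw [← hs] at hγ
      exact hγ
    · exact isNoetherian_groupHomology_pi (k := k) (fun i => Γ i.succ) (fun i => hΓ i.succ) _ j hj

end Products

/-! ### The kernel of a map onto an abelian group, and its group ring -/

section ChangeOfRings

open TensorProduct

/-- Group homology, as an abelian group, does not depend on the ring of coefficients over which
the chain complex is formed. -/
lemma groupHomology.nonempty_addEquiv {k R G : Type u} [CommRing k] [CommRing R] [Algebra k R]
    [Group G] {A : Rep.{u} k G} {B : Rep.{u} R G} (e : A ≃+ B)
    (he : ∀ (c : k) (a : A), e (c • a) = algebraMap k R c • e a)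
    (hρ : ∀ (g : G) (a : A), e (A.ρ g a) = B.ρ g (e a)) (n : ℕ) :
    Nonempty (groupHomology A n ≃+ groupHomology B n) := by
  let m (i : ℕ) : ((Fin i → G) →₀ A) ≃+ ((Fin i → G) →₀ B) := Finsupp.mapRange.addEquiv e
  have hm : ∀ (i : ℕ) (t : Fin i → G) (a : A),
      m i (Finsupp.single t a) = Finsupp.single t (e a) := fun i t a =>
    Finsupp.mapRange_single (hf := e.map_zero)
  have hd : ∀ (i : ℕ) (x : (Fin (i + 1) → G) →₀ A),
      m i ((inhomogeneousChains.d A i).hom x) =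
        (inhomogeneousChains.d B i).hom (m (i + 1) x) := by
    intro i x
    induction x using Finsupp.induction_linear with
    | zero => simp only [map_zero]
    | add x y hx hy => rw [map_add, map_add, map_add, hx, hy, map_add]
    | single t a =>
      have hsign : ∀ (l : ℕ) (y : (Fin i → G) →₀ A),
          m i ((-1 : k) ^ l • y) = (-1 : R) ^ l • m i y := fun l y => by
        induction l with
        | zero => simp only [pow_zero, one_smul]
        | succ l ih => rw [pow_succ', pow_succ', mul_smul, mul_smul, neg_one_smul, neg_one_smul,
            map_neg, ih]
      rw [hm]
      refine (congrArg (m i) (inhomogeneousChains.d_single i t a)).trans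
        (Eq.trans ?_ (inhomogeneousChains.d_single i t (e a)).symm)
      rw [map_add, map_sum, hm, hρ]
      simp only [hsign, hm]
  let F := ModuleCat.restrictScalars.{u} (algebraMap k R)
  let c (i : ℕ) : ((Fin i → G) →₀ A) ≃ₗ[k] F.obj (ModuleCat.of R ((Fin i → G) →₀ B)) :=
    { m i with map_smul' := fun r x => Finsupp.ext fun t => he r (x t) }
  -- Over `k`, the chain complex of `A` is the restriction of scalars of that of `B`, and
  -- restriction of scalars is exact.
  let E : inhomogeneousChains A ≅ (F.mapHomologicalComplex _).obj (inhomogeneousChains B) :=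
    HomologicalComplex.Hom.isoOfComponents (fun i => (c i).toModuleIso) (by
      rintro _ i rfl
      refine ModuleCat.hom_ext (LinearMap.ext fun x => ?_)
      have hA := congrArg (fun f => f.hom x) (inhomogeneousChains.d_def A i)
      have hB := congrArg (fun f => f.hom (m (i + 1) x)) (inhomogeneousChains.d_def B i)
      exact (hB.trans (hd i x).symm).trans (congrArg (m i) hA).symm)
  let I : groupHomology A n ≅ F.obj (groupHomology B n) :=
    (HomologicalComplex.homologyFunctor _ _ n).mapIso E ≪≫
      ((inhomogeneousChains B).sc n).mapHomologyIso F
  exact ⟨I.toLinearEquiv.toAddEquiv⟩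

end ChangeOfRings

section Shapiro

open TensorProduct

variable {k Q G : Type u} [CommRing k] [CommGroup Q] [Group G]

lemma leftRegular_ρ_apply (g : Q) (x : k[Q]) :
    (Rep.leftRegular k Q).ρ g x = MonoidAlgebra.single g (1 : k) * x := by
  induction x using MonoidAlgebra.induction_linear with
  | zero => exact (map_zero _).trans (mul_zero _).symm
  | add x y hx hy => exact (map_add _ x y).trans ((congrArg₂ (· + ·) hx hy).trans
      (mul_add _ _ _).symm)
  | single h c =>
    rw [MonoidAlgebra.single_mul_single, one_mul]
    simp

/-- Shapiro's lemma for the kernel of a surjection `q : G → Q` onto an abelian group, whose trivial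
representation induces `k[Q]`. -/
lemma nonempty_groupHomology_ker_addEquiv (q : G →* Q) (hq : Function.Surjective q) (j : ℕ) :
    Nonempty (groupHomology (Rep.trivial k q.ker k) j ≃+
      groupHomology (charRep ((MonoidAlgebra.of k Q).comp q)) j) := by
  -- With trivial character and `R = k`, the induced representation is `k ⊗[k] k[Q]`.
  obtain ⟨e₁⟩ := nonempty_twistedHomology_leftRegular_iso (k := k) (1 : G →* k) q hq j
  have e₂ : charRep ((1 : G →* k).comp q.ker.subtype) ≅ Rep.trivial k q.ker k :=
    Rep.mkIso (.mk (LinearEquiv.refl k k) fun g => by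
      ext
      simp)
  have e₃ := (groupHomology.functor k q.ker j).mapIso e₂
  obtain ⟨e₄⟩ := groupHomology.nonempty_addEquiv (n := j)
    (A := (twistedFunctor (1 : G →* k) q).obj (Rep.leftRegular k Q))
    (B := charRep ((MonoidAlgebra.of k Q).comp q))
    (TensorProduct.lid k k[Q]).toAddEquiv (fun c x => by
      exact ((TensorProduct.lid k k[Q]).map_smul c x).trans (algebraMap_smul k[Q] c _).symm)
    (fun g x => by
      change k ⊗[k] k[Q] at x
      induction x using TensorProduct.induction_on with
      | zero => 
        exact (congrArg (TensorProduct.lid k k[Q]) (((twistedFunctor (1 : G →* k) q).obj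
          (Rep.leftRegular k Q)).ρ g).map_zero).trans
          ((charRep ((MonoidAlgebra.of k Q).comp q)).ρ g).map_zero.symm
      | add x y hx hy =>
        refine (congrArg (TensorProduct.lid k k[Q]) (map_add _ x y)).trans ?_
        refine ((TensorProduct.lid k k[Q]).map_add _ _).trans ((congrArg₂ (· + ·) hx hy).trans ?_)
        exact (((charRep ((MonoidAlgebra.of k Q).comp q)).ρ g).map_add _ _).symm.trans
          (congrArg _ ((TensorProduct.lid k k[Q]).map_add x y).symm)
      | tmul c x =>
        refine (congrArg (TensorProduct.lid k k[Q])
          (twistedRep_ρ_tmul (1 : G →* k) q (Rep.leftRegular k Q) g c x)).trans ?_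
        rw [TensorProduct.lid_tmul]
        change _ = MonoidAlgebra.single (q g) (1 : k) * (TensorProduct.lid k k[Q]) (c ⊗ₜ[k] x)
        rw [TensorProduct.lid_tmul, mul_smul_comm, MonoidHom.one_apply, one_mul,
          leftRegular_ρ_apply])
  exact ⟨(e₁ ≪≫ e₃).toLinearEquiv.toAddEquiv.symm.trans e₄⟩

end Shapiro

section GroupRings

open TensorProduct

variable (k : Type*) {Q : Type*} [CommRing k] [CommGroup Q]

/-- If `x` generates a subgroup of finite index, then `k[Q] / (x - 1) = k[Q / ⟨x⟩]` is finite. -/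
lemma MonoidAlgebra.finite_quotient_span_of_sub_one [Module.Finite ℤ k] (x : Q)
    [Finite (Q ⧸ Subgroup.zpowers x)] :
    Module.Finite ℤ (k[Q] ⧸ Ideal.span {MonoidAlgebra.of k Q x - 1}) := by
  let I := Ideal.span {MonoidAlgebra.of k Q x - 1}
  let π : Q →* k[Q] ⧸ I := (Ideal.Quotient.mk I : k[Q] →* _).comp (MonoidAlgebra.of k Q)
  have hx : π x = 1 := by
    change Ideal.Quotient.mk I (MonoidAlgebra.of k Q x) = Ideal.Quotient.mk I 1
    exact Ideal.Quotient.eq.2 (Ideal.mem_span_singleton_self _)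
  -- Coset representatives of `⟨x⟩` span the quotient, since `x` becomes `1` there.
  let f : ((Q ⧸ Subgroup.zpowers x) →₀ k) →ₗ[k] k[Q] ⧸ I :=
    Finsupp.linearCombination k fun c => π c.out
  have : Module.Finite k (k[Q] ⧸ I) := by
    refine Module.Finite.of_surjective f fun y => ?_
    obtain ⟨y, rfl⟩ := Ideal.Quotient.mk_surjective y
    induction y using MonoidAlgebra.induction_on with
    | of y =>
      refine ⟨Finsupp.single (QuotientGroup.mk y) 1, ?_⟩
      obtain ⟨t, ht⟩ := QuotientGroup.mk_out_eq_mul (Subgroup.zpowers x) y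
      have ht' : π t = 1 := (Subgroup.zpowers_le (H := π.ker)).2 hx t.2
      rw [Finsupp.linearCombination_single, one_smul, ht, map_mul, ht', mul_one]
      rfl
    | add y z hy hz =>
      obtain ⟨y', hy⟩ := hy
      obtain ⟨z', hz⟩ := hz
      exact ⟨y' + z', by rw [map_add, map_add, hy, hz]⟩
    | smul c y hy =>
      obtain ⟨y', hy⟩ := hy
      exact ⟨c • y', by rw [map_smul, hy]; rfl⟩
  exact Module.Finite.trans k _

lemma Subgroup.finite_quotient_zpowers_of_injective (f : Q →* Multiplicative ℤ)
    (hf : Function.Injective f) {x : Q} (hx : x ≠ 1) : Finite (Q ⧸ Subgroup.zpowers x) := by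
  have h : Subgroup.zpowers x = (Subgroup.zpowers (f x)).comap f := by
    rw [← MonoidHom.map_zpowers, Subgroup.comap_map_eq_self_of_injective hf]
  have : (Subgroup.zpowers (f x)).FiniteIndex := by
    refine ⟨?_⟩
    have h1 : (Subgroup.zpowers (f x)).index = _ := Int.index_zmultiples (f x).toAdd
    rw [h1, Int.natAbs_ne_zero]
    exact fun h0 => hx (hf (h0.trans (map_one f).symm))
  rw [← Subgroup.finiteIndex_iff_finite_quotient, h, Subgroup.finiteIndex_iff,
    Subgroup.index_comap]
  exact (Subgroup.isFiniteRelIndex_of_finiteIndex (H := Subgroup.zpowers (f x))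
    (K := f.range)).relIndex_ne_zero

lemma MonoidAlgebra.isNoetherianRing_of_isCyclic [IsNoetherianRing k] [IsCyclic Q] :
    IsNoetherianRing k[Q] := by
  obtain ⟨x, hx⟩ := IsCyclic.exists_generator (α := Q)
  have : Group.FG Q := ⟨{x}, by
    rw [Finset.coe_singleton, ← Subgroup.zpowers_eq_closure]
    exact (Subgroup.eq_top_iff' _).2 hx⟩
  exact Algebra.FiniteType.isNoetherianRing k _

instance MonoidAlgebra.flat : Module.Flat k k[Q] :=
  Module.Flat.of_linearEquiv (MonoidAlgebra.coeffLinearEquiv k)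

end GroupRings

/-! ### Homology of the kernel -/

instance UInteger.isNoetherianRing : IsNoetherianRing UInteger.{u} :=
  isNoetherianRing_of_ringEquiv ℤ UInteger.ringEquivInt.{u}.symm

instance UInteger.finite_int : Module.Finite ℤ UInteger.{u} :=
  Module.Finite.equiv UInteger.ringEquivInt.{u}.symm.toAddEquiv.toIntLinearEquiv

theorem mainTheorem10 (n : ℕ) (Γ : Fin n → Type u) [∀ i, Group (Γ i)]
    (hΓ : ∀ i, IsFP UInteger.{u} (Γ i) n)
    (φ : (∀ i, Γ i) →* Multiplicative ℤ)
    (hφ : ∀ i, φ.comp (MonoidHom.mulSingle Γ i) ≠ 1)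
    (j : ℕ) (hj : j + 1 ≤ n) :
    AddGroup.FG (integralHomology φ.ker j) := by
  -- The image of `φ`, lifted to the universe of the groups, as `Rep` requires.
  let Q := ULift.{u} φ.range
  let q : (∀ i, Γ i) →* Q := MulEquiv.ulift.symm.toMonoidHom.comp φ.rangeRestrict
  let ι : Q →* Multiplicative ℤ := φ.range.subtype.comp MulEquiv.ulift.toMonoidHom
  have hι : Function.Injective ι := φ.range.subtype_injective.comp MulEquiv.ulift.injective
  have hq : Function.Surjective q :=
    MulEquiv.ulift.symm.surjective.comp φ.rangeRestrict_surjective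
  have hker : φ.ker = q.ker := by
    ext g
    exact map_eq_one_iff (x := q g) ι hι
  have : IsCyclic Q := isCyclic_of_injective ι hι
  have : IsNoetherianRing UInteger.{u}[Q] := MonoidAlgebra.isNoetherianRing_of_isCyclic _
  have h : IsNoetherian ℤ
      (groupHomology (charRep ((MonoidAlgebra.of UInteger.{u} Q).comp q)) j) := by
    refine isNoetherian_int_groupHomology_pi (k := UInteger.{u}) (n := n) Γ
      (fun i => hasFGPartialResolution_of_isFP (hΓ i)) _ (fun i => ?_) j (by omega) hj
    obtain ⟨γ, hγ⟩ := DFunLike.ne_iff.1 (hφ i)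
    have hx : q (MonoidHom.mulSingle Γ i γ) ≠ 1 := fun h => hγ (congrArg ι h)
    have := Subgroup.finite_quotient_zpowers_of_injective ι hι hx
    exact ⟨γ, MonoidAlgebra.finite_quotient_span_of_sub_one _ _⟩
  obtain ⟨e⟩ := nonempty_groupHomology_ker_addEquiv (k := UInteger.{u}) q hq j
  unfold integralHomology
  rw [hker]
  exact Module.Finite.iff_addGroup_fg.1 (Module.Finite.equiv e.toIntLinearEquiv.symm)
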